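/- Let $n \ge 1$ and let $\mathfrak{B}_n$ be the hyperoctahedral group, i.e. the group under composition of all bijections $\pi$ of $\{-n,\ldots,-1,0,1,\ldots,n\}$ with $\pi(-i) = -\pi(i)$ for all $i$ (so $\pi(0)=0$). A peak of $\pi \in \mathfrak{B}_n$ is a position $i \in \{1,\ldots,n-1\}$ with $\pi(i-1) < \pi(i) > \pi(i+1)$. For $i \ge 0$ let $E_i^{+}$ (respectively $E_i^{-}$) denote the sum, in the group algebra $\mathbb{Q}[\mathfrak{B}_n]$, of all $\pi \in \mathfrak{B}_n$ with exactly $i$ peaks and $\pi(1) > 0$ (respectively $\pi(1) < 0$). Then the $\mathbb{Q}$-linear span $\mathfrak{p}_{B,n}$ of all the elements $E_i^{+}$ and $E_i^{-}$, $i \ge 0$, is a unital subalgebra of $\mathbb{Q}[\mathfrak{B}_n]$; it is commutative and has dimension $n+1$ over $\mathbb{Q}$. -/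

import Mathlib

/-- The set `±[n] = {-n, …, -1, 0, 1, …, n}`. -/
abbrev SignedInterval (n : ℕ) : Type := ↥(Finset.Icc (-(n : ℤ)) n)

/-- The involution `i ↦ -i` of `±[n]`. -/
def SignedInterval.neg {n : ℕ} (i : SignedInterval n) : SignedInterval n :=
  ⟨-i.1, by have h := Finset.mem_Icc.1 i.2; exact Finset.mem_Icc.2 (by omega)⟩

/-- The hyperoctahedral group `𝔅ₙ`: the bijections `π : ±[n] → ±[n]` with `π(-i) = -π(i)`,
under composition. -/
def SignedPerm (n : ℕ) : Subgroup (Equiv.Perm (SignedInterval n)) where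
  carrier := {π | ∀ i, π i.neg = (π i).neg}
  one_mem' := fun _ => rfl
  mul_mem' := by
    intro a b ha hb i
    change a (b i.neg) = (a (b i)).neg
    rw [hb, ha]
  inv_mem' := by
    intro a ha i
    apply a.injective
    rw [ha]
    simp

namespace SignedPerm

variable {n : ℕ}

noncomputable instance : Fintype (SignedPerm n) := Fintype.ofFinite _

/-- The integer `π(i)` for `-n ≤ i ≤ n` (and `0`, for other `i`, a value that is never used when `1 ≤ n`). -/
noncomputable def app (π : SignedPerm n) (i : ℤ) : ℤ :=
  if h : i ∈ Finset.Icc (-(n : ℤ)) n then ((π.1 ⟨i, h⟩ : SignedInterval n) : ℤ) else 0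

/-- The set of peaks: positions `i ∈ {1, …, n - 1}` with `π(i-1) < π(i) > π(i+1)`
(where `π(0) = 0`). -/
noncomputable def peakSet (π : SignedPerm n) : Finset ℤ :=
  {i ∈ Finset.Icc (1 : ℤ) ((n : ℤ) - 1) | app π (i - 1) < app π i ∧ app π (i + 1) < app π i}

/-- The number of peaks. -/
noncomputable def peakNumber (π : SignedPerm n) : ℕ := (peakSet π).card

end SignedPerm

/-- `Eᵢ⁺`: the sum in `ℚ[𝔅ₙ]` of all signed permutations with `i` peaks and `π(1) > 0`. -/
noncomputable def peakSumPos (n i : ℕ) : MonoidAlgebra ℚ (SignedPerm n) :=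
  ∑ π : SignedPerm n with SignedPerm.peakNumber π = i ∧ 0 < SignedPerm.app π 1,
    MonoidAlgebra.of ℚ (SignedPerm n) π

/-- `Eᵢ⁻`: the sum in `ℚ[𝔅ₙ]` of all signed permutations with `i` peaks and `π(1) < 0`. -/
noncomputable def peakSumNeg (n i : ℕ) : MonoidAlgebra ℚ (SignedPerm n) :=
  ∑ π : SignedPerm n with SignedPerm.peakNumber π = i ∧ SignedPerm.app π 1 < 0,
    MonoidAlgebra.of ℚ (SignedPerm n) π

/-- The linear span `𝔭_{B,n}` of the elements `Eᵢ⁺` and `Eᵢ⁻`. -/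
noncomputable def peakSpanB (n : ℕ) : Submodule ℚ (MonoidAlgebra ℚ (SignedPerm n)) :=
  Submodule.span ℚ (Set.range (peakSumPos n) ∪ Set.range (peakSumNeg n))

/-!
Consider words of length `n` in the alphabet `±[k]`, extended to odd functions on `±[n]`. The
standardization of a word is the signed permutation that sorts its positions by their letters,
positions with the same letter being taken increasingly if the letter is even and decreasingly if it
is odd. Let `S k` be the sum of the standardizations of all words. A word in `±[k]` and a word in
`±[l]`, with letters suitably rearranged and negated, are the digits in balanced base `2k + 1` of
one word in `±[2kl + k + l]`, and the parity rule makes standardization multiplicative for this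
composition. Hence `S k * S l = S (2kl + k + l)`: the sums `S k` commute, and those with `k` even
form a monoid.

The coefficient of `π` in `S k` is the number of chains `0 = a₀ ≤ ⋯ ≤ aₙ ≤ k` in which an equality
`aₘ = aₘ₊₁` is allowed only at an odd letter if `π` descends from `m` to `m + 1`, and only at an
even one otherwise. For `k = 2K`, the generating function in `K` of these numbers is
`2 ^ j * X ^ ⌈j / 2⌉ * (1 + X) ^ (n - j) / (1 - X) ^ (n + 1)`, where `j` is twice the number of
peaks of `π`, plus one if `π(1) < 0`. So `S (2K)` lies in the span of the peak sums, and as the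
`n + 1` generating functions are linearly independent, these elements span it.
-/

open Function

section Digits

variable {k l : ℕ} {a b c d : ℤ}

theorem exists_abs_le_and_mul_add_eq (k : ℕ) (c : ℤ) :
    ∃ a b : ℤ, |b| ≤ k ∧ (2 * k + 1) * a + b = c := by
  have hlower := Int.le_bmod (x := c) (m := 2 * k + 1) (by omega)
  have hupper := Int.bmod_lt (x := c) (m := 2 * k + 1) (by omega)
  refine ⟨c.bdiv (2 * k + 1), c.bmod (2 * k + 1), abs_le.2 (by omega), ?_⟩
  exact_mod_cast Int.bdiv_add_bmod c (2 * k + 1)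

theorem mul_add_lt_mul_add (hb : |b| ≤ k) (hd : |d| ≤ k) (h : a < c) :
    (2 * k + 1) * a + b < (2 * k + 1) * c + d := by
  nlinarith [le_abs_self b, neg_abs_le d]

theorem eq_and_eq_of_mul_add_eq_mul_add (hb : |b| ≤ k) (hd : |d| ≤ k)
    (h : (2 * k + 1) * a + b = (2 * k + 1) * c + d) : a = c ∧ b = d := by
  obtain hac | rfl | hca := lt_trichotomy a c
  · exact absurd h (mul_add_lt_mul_add hb hd hac).ne
  · exact ⟨rfl, add_left_cancel h⟩
  · exact absurd h (mul_add_lt_mul_add hd hb hca).ne'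

theorem abs_le_of_abs_mul_add_le (hb : |b| ≤ k) (h : |(2 * k + 1) * a + b| ≤ 2 * k * l + k + l) :
    |a| ≤ l := by
  obtain ⟨hlower, hupper⟩ := abs_le.1 h
  refine abs_le.2 ⟨le_of_not_gt fun ha => ?_, le_of_not_gt fun ha => ?_⟩
  · linarith [mul_add_lt_mul_add (d := -k) hb (by simp) ha]
  · linarith [mul_add_lt_mul_add (b := k) (by simp) hb ha]

end Digits

theorem existsUnique_perm_strictMono_comp {α β : Type*} [Finite α] [LinearOrder α] [LinearOrder β]
    {f : α → β} (hf : Injective f) : ∃! π : Equiv.Perm α, StrictMono (f ∘ π) := by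
  classical
  have := Fintype.ofFinite α
  let e : α ≃o Set.range f := (Fintype.orderIsoFinOfCardEq α rfl).symm.trans
    (Fintype.orderIsoFinOfCardEq (Set.range f) (Set.card_range_of_injective hf))
  let π : Equiv.Perm α := e.toEquiv.trans (Equiv.ofInjective f hf).symm
  have hπ : StrictMono (f ∘ π) := fun a b h => by
    simpa [π, Equiv.apply_ofInjective_symm] using h
  refine ⟨π, hπ, fun σ hσ => Equiv.ext fun a => ?_⟩
  have h : f ∘ σ = f ∘ π := by
    rw [← hσ.range_inj hπ, σ.surjective.range_comp, π.surjective.range_comp]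
  exact hf (congrFun h a)

namespace SignedInterval

variable {n : ℕ}

@[simp]
theorem coe_neg (x : SignedInterval n) : (x.neg : ℤ) = -x := rfl

@[simp]
theorem neg_neg (x : SignedInterval n) : x.neg.neg = x := Subtype.ext (_root_.neg_neg _)

theorem neg_strictAnti : StrictAnti (neg : SignedInterval n → SignedInterval n) :=
  fun _ _ h => Int.neg_lt_neg h

/-- The involution `x ↦ -x` as a permutation of `±[n]`. -/
def negPerm (n : ℕ) : Equiv.Perm (SignedInterval n) := ⟨neg, neg, neg_neg, neg_neg⟩

/-- The inclusion of the nonnegative half `{0, …, n}` into `±[n]`. -/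
def ofFin (m : Fin (n + 1)) : SignedInterval n := ⟨m, Finset.mem_Icc.2 (by omega)⟩

@[simp]
theorem coe_ofFin (m : Fin (n + 1)) : (ofFin m : ℤ) = (m : ℕ) := rfl

theorem ofFin_strictMono : StrictMono (ofFin : Fin (n + 1) → SignedInterval n) :=
  fun _ _ h => Int.ofNat_lt.2 h

theorem exists_eq_ofFin_or_eq_neg (x : SignedInterval n) :
    ∃ m, x = ofFin m ∨ x = (ofFin m).neg := by
  have hx := Finset.mem_Icc.1 x.2
  refine ⟨⟨(x : ℤ).natAbs, by omega⟩, ?_⟩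
  rcases le_total 0 (x : ℤ) with h | h
  · exact .inl (Subtype.ext (by simp [abs_of_nonneg h]))
  · exact .inr (Subtype.ext (by simp [abs_of_nonpos h]))

section Odd

variable {G : Type*}

theorem odd_ext [Neg G] {f g : SignedInterval n → G} (hf : ∀ x, f x.neg = -f x)
    (hg : ∀ x, g x.neg = -g x) (h : ∀ m, f (ofFin m) = g (ofFin m)) : f = g := by
  funext x
  obtain ⟨m, rfl | rfl⟩ := x.exists_eq_ofFin_or_eq_neg
  · exact h m
  · rw [hf, hg, h]

open Classical in
theorem exists_odd_extension [SubtractionMonoid G] {a : Fin (n + 1) → G} (h0 : a 0 = 0) :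
    ∃ f : SignedInterval n → G, (∀ x, f x.neg = -f x) ∧ ∀ m, f (ofFin m) = a m := by
  let abs (x : SignedInterval n) : Fin (n + 1) :=
    ⟨(x : ℤ).natAbs, by have := Finset.mem_Icc.1 x.2; omega⟩
  have abs_eq_zero {x : SignedInterval n} (hx : (x : ℤ) = 0) : abs x = 0 := by
    simp [abs, hx]
  have abs_neg (x : SignedInterval n) : abs x.neg = abs x := by simp [abs]
  refine ⟨fun x => if 0 ≤ (x : ℤ) then a (abs x) else -a (abs x), fun x => ?_, fun m => ?_⟩
  · obtain hx | hx | hx := lt_trichotomy (x : ℤ) 0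
    · simp [abs_neg, hx.not_ge, hx.le]
    · simp [hx, abs_neg, abs_eq_zero hx, h0]
    · simp [abs_neg, hx.not_ge, hx.le]
  · simp [abs]

variable [AddCommGroup G] [LinearOrder G] [IsOrderedAddMonoid G] {f : SignedInterval n → G}

theorem odd_apply_zero (hf : ∀ x, f x.neg = -f x) : f (ofFin 0) = 0 :=
  self_eq_neg.1 (hf (ofFin 0))

theorem strictMono_of_odd (hf : ∀ x, f x.neg = -f x) (h : StrictMono (f ∘ ofFin)) :
    StrictMono f := by
  have nonneg (m : Fin (n + 1)) : 0 ≤ f (ofFin m) :=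
    (odd_apply_zero hf).ge.trans (h.monotone (Fin.zero_le m))
  have pos (m : Fin (n + 1)) (hm : m ≠ 0) : 0 < f (ofFin m) :=
    (odd_apply_zero hf).ge.trans_lt (h (Fin.pos_iff_ne_zero.2 hm))
  intro x y hxy
  obtain ⟨a, rfl | rfl⟩ := x.exists_eq_ofFin_or_eq_neg <;>
    obtain ⟨b, rfl | rfl⟩ := y.exists_eq_ofFin_or_eq_neg
  · exact h (ofFin_strictMono.lt_iff_lt.1 hxy)
  · have hab : ((a : ℕ) : ℤ) < -(b : ℕ) := hxy
    omega
  · rw [hf]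
    by_cases ha : a = 0
    · have hb : b ≠ 0 := by
        rintro rfl
        have h0 : -((a : ℕ) : ℤ) < 0 := hxy
        simp [ha] at h0
      exact (neg_nonpos.2 (nonneg a)).trans_lt (pos b hb)
    · exact (neg_neg_of_pos (pos a ha)).trans_le (nonneg b)
  · rw [hf, hf]
    exact _root_.neg_lt_neg (h (ofFin_strictMono.lt_iff_lt.1 (neg_strictAnti.lt_iff_gt.1 hxy)))

end Odd

end SignedInterval

open SignedInterval

namespace SignedPerm

variable {n : ℕ}

theorem apply_neg (π : SignedPerm n) (x : SignedInterval n) : π.1 x.neg = (π.1 x).neg := π.2 x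

theorem inv_apply_neg (π : SignedPerm n) (x : SignedInterval n) :
    π⁻¹.1 x.neg = (π⁻¹.1 x).neg :=
  π⁻¹.2 x

@[simp]
theorem inv_apply_self (π : SignedPerm n) (x : SignedInterval n) : π⁻¹.1 (π.1 x) = x :=
  Equiv.symm_apply_apply π.1 x

@[simp]
theorem apply_inv_self (π : SignedPerm n) (x : SignedInterval n) : π.1 (π⁻¹.1 x) = x :=
  Equiv.apply_symm_apply π.1 x

theorem app_natCast (π : SignedPerm n) (m : Fin (n + 1)) : app π (m : ℕ) = π.1 (ofFin m) :=
  dif_pos (ofFin m).2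

theorem app_castSucc (π : SignedPerm n) (m : Fin n) :
    app π (m : ℕ) = π.1 (ofFin m.castSucc) :=
  app_natCast π m.castSucc

theorem app_succ (π : SignedPerm n) (m : Fin n) :
    app π ((m : ℕ) + 1) = π.1 (ofFin m.succ) := by
  rw [← app_natCast, Fin.val_succ, Nat.cast_succ]

theorem app_zero (π : SignedPerm n) : app π 0 = 0 :=
  (app_natCast π 0).trans <|
    odd_apply_zero (f := fun x => (π.1 x : ℤ)) fun x => congrArg Subtype.val (apply_neg π x)

theorem apply_ofFin_succ_ne (π : SignedPerm n) (m : Fin n) :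
    π.1 (ofFin m.succ) ≠ π.1 (ofFin m.castSucc) :=
  (π.1.injective.comp ofFin_strictMono.injective).ne Fin.castSucc_lt_succ.ne'

theorem app_succ_ne (π : SignedPerm n) (m : Fin n) : app π ((m : ℕ) + 1) ≠ app π (m : ℕ) := by
  rw [app_succ, app_castSucc]
  exact Subtype.coe_injective.ne (apply_ofFin_succ_ne π m)

/-- The step from position `m` to position `m + 1` is a descent. -/
def Descent (π : SignedPerm n) (m : ℕ) : Prop := app π (m + 1) < app π m

theorem descent_iff (π : SignedPerm n) (m : Fin n) :
    Descent π m ↔ π.1 (ofFin m.succ) < π.1 (ofFin m.castSucc) := by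
  rw [Descent, app_succ, app_castSucc, Subtype.coe_lt_coe]

end SignedPerm

/-! ### Words and their standardization -/

/-- A word of length `n` in the alphabet `±[k]`, encoded by its odd extension to the positions
`±[n]`. -/
structure SignedWord (n k : ℕ) where
  toFun : SignedInterval n → ℤ
  map_neg' : ∀ x, toFun x.neg = -toFun x
  abs_le' : ∀ x, |toFun x| ≤ k

namespace SignedWord

variable {n k l : ℕ}

instance : FunLike (SignedWord n k) (SignedInterval n) ℤ where
  coe := toFun
  coe_injective := fun ⟨_, _, _⟩ ⟨_, _, _⟩ h => by congr

@[simp]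
theorem coe_mk (f : SignedInterval n → ℤ) (hf hk) : ⇑(⟨f, hf, hk⟩ : SignedWord n k) = f := rfl

@[simp]
theorem map_neg (w : SignedWord n k) (x : SignedInterval n) : w x.neg = -w x := w.map_neg' x

theorem abs_le (w : SignedWord n k) (x : SignedInterval n) : |w x| ≤ k := w.abs_le' x

instance : Finite (SignedWord n k) :=
  .of_injective (fun w x => (⟨w x, Finset.mem_Icc.2 (_root_.abs_le.1 (w.abs_le x))⟩ :
    SignedInterval k)) fun _ _ h => DFunLike.ext _ _ fun x => congrArg Subtype.val (congrFun h x)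

noncomputable instance : Fintype (SignedWord n k) := Fintype.ofFinite _

/-- The key by which a word orders its positions: letters are compared first, and positions with
the same letter are taken increasingly if the letter is even and decreasingly if it is odd. -/
def key (w : SignedWord n k) (x : SignedInterval n) : ℤ ×ₗ ℤ :=
  toLex (w x, (w x).negOnePow * x)

theorem key_neg (w : SignedWord n k) (x : SignedInterval n) : w.key x.neg = -w.key x := by
  simp only [key, map_neg, Int.negOnePow_neg, coe_neg, mul_neg]
  rfl

theorem key_lt_key_iff (w : SignedWord n k) {x y : SignedInterval n} :
    w.key x < w.key y ↔
      w x < w y ∨ w x = w y ∧ (w x).negOnePow * (x : ℤ) < (w y).negOnePow * y :=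
  Prod.Lex.toLex_lt_toLex

theorem key_injective (w : SignedWord n k) : Injective w.key := by
  intro x y h
  obtain ⟨hw, hxy⟩ := Prod.ext_iff.1 (toLex.injective h)
  simp only at hw hxy
  rw [hw] at hxy
  exact Subtype.ext (mul_left_cancel₀ (Units.ne_zero _) hxy)

theorem existsUnique_strictMono_key_comp (w : SignedWord n k) :
    ∃! π : SignedPerm n, StrictMono (w.key ∘ π.1) := by
  obtain ⟨π, hπ, hunique⟩ := existsUnique_perm_strictMono_comp w.key_injective
  have hconj : negPerm n * π * negPerm n = π := by
    refine hunique _ fun x y hxy => ?_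
    change w.key (π x.neg).neg < w.key (π y.neg).neg
    rw [key_neg, key_neg]
    exact neg_lt_neg (hπ (neg_strictAnti hxy))
  have hodd (x : SignedInterval n) : π x.neg = (π x).neg := by
    conv_lhs => rw [← hconj]
    change (π x.neg.neg).neg = _
    rw [SignedInterval.neg_neg]
  exact ⟨⟨π, hodd⟩, hπ, fun σ hσ => Subtype.ext (hunique σ.1 hσ)⟩

/-- The standardization of a word: the signed permutation that sorts its positions by `key`. -/
noncomputable def std (w : SignedWord n k) : SignedPerm n :=
  w.existsUnique_strictMono_key_comp.choose

theorem std_eq_iff (w : SignedWord n k) {π : SignedPerm n} :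
    w.std = π ↔ StrictMono (w.key ∘ π.1) := by
  obtain ⟨hstd, hunique⟩ := w.existsUnique_strictMono_key_comp.choose_spec
  exact ⟨fun h => h ▸ hstd, fun h => (hunique π h).symm⟩

theorem strictMono_key_comp_std (w : SignedWord n k) : StrictMono (w.key ∘ w.std.1) :=
  w.std_eq_iff.1 rfl

section Comp

/-- The composition of two words: the letters of `v`, read at the positions `u.std⁻¹`, are the
leading digits in base `2 * k + 1`, and the letters of `u`, with their order reversed where the
leading digit is odd, are the last digits. -/
noncomputable def comp (u : SignedWord n k) (v : SignedWord n l) :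
    SignedWord n (2 * k * l + k + l) where
  toFun x := (2 * k + 1) * v (u.std⁻¹.1 x) + (v (u.std⁻¹.1 x)).negOnePow * u x
  map_neg' x := by
    simp only [SignedPerm.apply_neg, map_neg, Int.negOnePow_neg]
    ring
  abs_le' x := by
    calc |(2 * k + 1) * v (u.std⁻¹.1 x) + (v (u.std⁻¹.1 x)).negOnePow * u x|
        ≤ (2 * k + 1) * |v (u.std⁻¹.1 x)| + |u x| := by
          refine (abs_add_le _ _).trans_eq ?_
          rw [abs_mul, abs_mul, Int.abs_negOnePow, one_mul, abs_of_nonneg (by positivity)]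
      _ ≤ (2 * k + 1) * l + k := by gcongr <;> exact abs_le _ _
      _ = (2 * k * l + k + l : ℕ) := by push_cast; ring

theorem comp_apply (u : SignedWord n k) (v : SignedWord n l) (y : SignedInterval n) :
    u.comp v (u.std.1 y) = (2 * k + 1) * v y + (v y).negOnePow * u (u.std.1 y) := by
  simp only [comp, coe_mk, SignedPerm.inv_apply_self]

theorem negOnePow_comp_apply (u : SignedWord n k) (v : SignedWord n l) (y : SignedInterval n) :
    (u.comp v (u.std.1 y)).negOnePow = (v y).negOnePow * (u (u.std.1 y)).negOnePow := by
  have hparity (a : ℤ) : ((2 * k + 1) * a).negOnePow = a.negOnePow := by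
    rw [add_mul, one_mul, mul_assoc, Int.negOnePow_add, Int.negOnePow_two_mul, one_mul]
  rw [comp_apply, Int.negOnePow_add, hparity]
  obtain h | h := Int.units_eq_one_or (v y).negOnePow <;> simp [h]

theorem std_comp (u : SignedWord n k) (v : SignedWord n l) : (u.comp v).std = u.std * v.std := by
  refine (std_eq_iff _).2 fun i j hij => ?_
  change (u.comp v).key (u.std.1 (v.std.1 i)) < (u.comp v).key (u.std.1 (v.std.1 j))
  have hv := v.strictMono_key_comp_std hij
  simp only [Function.comp_apply] at hv
  generalize v.std.1 i = x at hv ⊢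
  generalize v.std.1 j = y at hv ⊢
  rw [key_lt_key_iff, negOnePow_comp_apply, negOnePow_comp_apply, comp_apply, comp_apply]
  obtain hlt | ⟨heq, hxy⟩ := v.key_lt_key_iff.1 hv
  · refine .inl (mul_add_lt_mul_add ?_ ?_ hlt) <;>
      simpa only [abs_mul, Int.abs_negOnePow, one_mul] using abs_le _ _
  · rw [heq] at hxy ⊢
    rw [add_lt_add_iff_left, add_right_inj]
    obtain hε | hε := Int.units_eq_one_or (v y).negOnePow <;> rw [hε] at hxy ⊢
    · have hu := u.strictMono_key_comp_std (show x < y by simpa using hxy)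
      simpa [key_lt_key_iff] using hu
    · have hu := u.strictMono_key_comp_std (show y < x by simpa using hxy)
      simpa [key_lt_key_iff, eq_comm] using hu

theorem comp_injective :
    Injective fun p : SignedWord n k × SignedWord n l => p.1.comp p.2 := by
  rintro ⟨u, v⟩ ⟨u', v'⟩ h
  have hdigits (x : SignedInterval n) : v (u.std⁻¹.1 x) = v' (u'.std⁻¹.1 x) ∧ u x = u' x := by
    obtain ⟨hv, hu⟩ := eq_and_eq_of_mul_add_eq_mul_add (k := k)
      (by simpa only [abs_mul, Int.abs_negOnePow, one_mul] using abs_le _ _)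
      (by simpa only [abs_mul, Int.abs_negOnePow, one_mul] using abs_le _ _)
      (DFunLike.congr_fun h x)
    rw [hv] at hu
    exact ⟨hv, mul_left_cancel₀ (Units.ne_zero _) hu⟩
  obtain rfl : u = u' := DFunLike.ext _ _ fun x => (hdigits x).2
  refine Prod.ext rfl (DFunLike.ext _ _ fun y => ?_)
  simpa using (hdigits (u.std.1 y)).1

theorem comp_surjective :
    Surjective fun p : SignedWord n k × SignedWord n l => p.1.comp p.2 := by
  intro w
  choose b e he hbe using fun x => exists_abs_le_and_mul_add_eq k (w x)
  have hodd (x : SignedInterval n) : b x.neg = -b x ∧ e x.neg = -e x := by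
    refine eq_and_eq_of_mul_add_eq_mul_add (he _) ((abs_neg _).trans_le (he x)) ?_
    rw [hbe, map_neg, ← hbe]
    ring
  let u : SignedWord n k :=
    { toFun x := (b x).negOnePow * e x
      map_neg' x := by rw [(hodd x).1, (hodd x).2, Int.negOnePow_neg, mul_neg]
      abs_le' x := by simpa only [abs_mul, Int.abs_negOnePow, one_mul] using he x }
  let v : SignedWord n l :=
    { toFun y := b (u.std.1 y)
      map_neg' y := by rw [SignedPerm.apply_neg, (hodd _).1]
      abs_le' y := abs_le_of_abs_mul_add_le (he _) <| by
        rw [hbe]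
        exact_mod_cast w.abs_le _ }
  refine ⟨(u, v), DFunLike.ext _ _ fun x => ?_⟩
  have hu : u x = (b x).negOnePow * e x := rfl
  have hv : v (u.std⁻¹.1 x) = b x := congrArg b (SignedPerm.apply_inv_self _ _)
  change (2 * k + 1) * v (u.std⁻¹.1 x) + (v (u.std⁻¹.1 x)).negOnePow * u x = w x
  rw [hv, hu, ← mul_assoc, ← hbe x]
  simp [← Units.val_mul]

end Comp

/-- The sum, in the group algebra, of the standardizations of all words in the alphabet `±[k]`. -/
noncomputable def stdSum (n k : ℕ) : MonoidAlgebra ℚ (SignedPerm n) :=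
  ∑ w : SignedWord n k, MonoidAlgebra.of ℚ (SignedPerm n) w.std

theorem stdSum_mul (n k l : ℕ) : stdSum n k * stdSum n l = stdSum n (2 * k * l + k + l) := by
  rw [stdSum, stdSum, Finset.sum_mul_sum, ← Finset.sum_product']
  refine Fintype.sum_bijective (fun p : SignedWord n k × SignedWord n l => p.1.comp p.2)
    ⟨comp_injective, comp_surjective⟩ _ _ fun p => ?_
  rw [std_comp, map_mul]

theorem stdSum_zero (n : ℕ) : stdSum n 0 = 1 := by
  have hzero (w : SignedWord n 0) (x : SignedInterval n) : w x = 0 :=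
    abs_nonpos_iff.1 (by exact_mod_cast w.abs_le x)
  let zero : SignedWord n 0 := ⟨fun _ => 0, fun _ => neg_zero.symm, fun _ => by simp⟩
  have : Unique (SignedWord n 0) :=
    ⟨⟨zero⟩, fun w => DFunLike.ext _ _ fun x => (hzero w x).trans (hzero zero x).symm⟩
  have hstd (w : SignedWord n 0) : w.std = 1 :=
    (std_eq_iff _).2 fun x y hxy => w.key_lt_key_iff.2 <| .inr <| by
      simpa [hzero] using hxy
  rw [stdSum, Fintype.sum_unique, hstd, map_one]

theorem stdSum_comm (n k l : ℕ) : stdSum n k * stdSum n l = stdSum n l * stdSum n k := by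
  rw [stdSum_mul, stdSum_mul, mul_right_comm 2 k l, add_right_comm]

end SignedWord

/-! ### Counting the words with a given standardization -/

/-- One step in a weakly increasing chain of letters: the letter increases, or it stays the same and
is odd or even according to whether the step is to be a descent (`D`) or an ascent. -/
def ChainStep (D : Prop) (b c : ℕ) : Prop := b < c ∨ b = c ∧ (Odd c ↔ D)

theorem ChainStep.le {D : Prop} {b c : ℕ} (h : ChainStep D b c) : b ≤ c := by
  obtain h | h := h
  exacts [h.le, h.1.le]

section Chains

variable {d : ℕ → Prop} {i c : ℕ}

open Classical in
/-- The chains of letters `0 = a₀ ≤ ⋯ ≤ aᵢ = c` whose steps follow the directions `d`. -/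
noncomputable def chains (d : ℕ → Prop) (i c : ℕ) : Finset (Fin (i + 1) → ℕ) :=
  {a ∈ Fintype.piFinset fun _ => Finset.range (c + 1) |
    a 0 = 0 ∧ (∀ m : Fin i, ChainStep (d m) (a m.castSucc) (a m.succ)) ∧ a (Fin.last i) = c}

theorem monotone_of_forall_chainStep {a : Fin (i + 1) → ℕ}
    (h : ∀ m : Fin i, ChainStep (d m) (a m.castSucc) (a m.succ)) : Monotone a :=
  Fin.monotone_iff_le_succ.2 fun m => (h m).le

theorem mem_chains {a : Fin (i + 1) → ℕ} :
    a ∈ chains d i c ↔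
      a 0 = 0 ∧ (∀ m : Fin i, ChainStep (d m) (a m.castSucc) (a m.succ)) ∧ a (Fin.last i) = c := by
  classical
  refine Finset.mem_filter.trans (and_iff_right_of_imp fun ⟨_, hstep, hlast⟩ => ?_)
  refine Fintype.mem_piFinset.2 fun m => Finset.mem_range_succ_iff.2 ?_
  exact (monotone_of_forall_chainStep hstep (Fin.le_last m)).trans_eq hlast

theorem snoc_mem_chains {a : Fin (i + 1) → ℕ} {b : ℕ} (ha : a ∈ chains d i b)
    (hbc : ChainStep (d i) b c) : (Fin.snoc a c : Fin (i + 2) → ℕ) ∈ chains d (i + 1) c := by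
  obtain ⟨h0, hstep, rfl⟩ := mem_chains.1 ha
  refine mem_chains.2 ⟨?_, Fin.forall_fin_succ'.2 ⟨fun m => ?_, ?_⟩, Fin.snoc_last ..⟩
  · exact (Fin.snoc_castSucc (α := fun _ => ℕ) c a 0).trans h0
  · simpa only [Fin.succ_castSucc, Fin.snoc_castSucc, Fin.val_castSucc] using hstep m
  · simpa only [Fin.succ_last, Fin.snoc_castSucc, Fin.snoc_last, Fin.val_last] using hbc

open Classical in
theorem card_chains_succ (d : ℕ → Prop) (i c : ℕ) :
    (chains d (i + 1) c).card =
      ∑ b ∈ Finset.range (c + 1) with ChainStep (d i) b c, (chains d i b).card := by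
  rw [Finset.card_eq_sum_card_fiberwise (f := fun a => a (Fin.last i).castSucc)]
  · refine Finset.sum_congr rfl fun b hb => ?_
    refine Finset.card_nbij' Fin.init (fun a => Fin.snoc a c) ?_ ?_ ?_ ?_
    · intro a ha
      obtain ⟨hchain, rfl⟩ := Finset.mem_filter.1 ha
      obtain ⟨h0, hstep, -⟩ := mem_chains.1 hchain
      exact mem_chains.2 ⟨h0, fun m => hstep m.castSucc, rfl⟩
    · intro a ha
      refine Finset.mem_filter.2 ⟨snoc_mem_chains ha (Finset.mem_filter.1 hb).2, ?_⟩
      exact (Fin.snoc_castSucc (α := fun _ => ℕ) c a _).trans (mem_chains.1 ha).2.2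
    · intro a ha
      obtain ⟨-, -, rfl⟩ := mem_chains.1 (Finset.mem_filter.1 ha).1
      exact Fin.snoc_init_self a
    · exact fun a _ => Fin.init_snoc ..
  · intro a ha
    obtain ⟨-, hstep, rfl⟩ := mem_chains.1 ha
    have hlast := hstep (Fin.last i)
    exact Finset.mem_filter.2 ⟨Finset.mem_range_succ_iff.2 hlast.le, hlast⟩

theorem card_chains_succ_of_odd_iff (h : Odd c ↔ d i) :
    (chains d (i + 1) c).card = ∑ b ∈ Finset.range (c + 1), (chains d i b).card := by
  classical
  rw [card_chains_succ, Finset.filter_true_of_mem]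
  exact fun b hb => (Finset.mem_range_succ_iff.1 hb).lt_or_eq.imp_right fun hbc => ⟨hbc, h⟩

theorem card_chains_succ_of_not_odd_iff (h : ¬(Odd c ↔ d i)) :
    (chains d (i + 1) c).card = ∑ b ∈ Finset.range c, (chains d i b).card := by
  classical
  rw [card_chains_succ]
  congr 1
  ext b
  simp only [ChainStep, h, and_false, or_false, Finset.mem_filter, Finset.mem_range]
  lia

theorem card_chains_zero (d : ℕ → Prop) (c : ℕ) :
    (chains d 0 c).card = if c = 0 then 1 else 0 := by
  split_ifs with hc
  · refine Finset.card_eq_one.2 ⟨0, Finset.ext fun a => ?_⟩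
    simp [mem_chains, hc, funext_iff, Fin.forall_fin_one]
  · refine Finset.card_eq_zero.2 (Finset.eq_empty_of_forall_notMem fun a ha => hc ?_)
    obtain ⟨h0, -, rfl⟩ := mem_chains.1 ha
    exact h0

end Chains

namespace SignedWord

variable {n k : ℕ}

section CardStd

variable {w : SignedWord n k} {π : SignedPerm n} {a : Fin (n + 1) → ℕ}

theorem apply_zero (w : SignedWord n k) (π : SignedPerm n) : w (π.1 (ofFin 0)) = 0 :=
  odd_apply_zero (f := w ∘ π.1) fun x =>
    (congrArg w (SignedPerm.apply_neg π x)).trans (w.map_neg _)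

theorem apply_nonneg_of_std_eq (h : w.std = π) (m : Fin (n + 1)) : 0 ≤ w (π.1 (ofFin m)) := by
  have hkey := ((w.std_eq_iff.1 h).comp ofFin_strictMono).monotone (Fin.zero_le m)
  rw [← w.apply_zero π]
  exact (Prod.Lex.le_iff.1 hkey).elim le_of_lt fun h => h.1.le

theorem key_lt_key_iff_chainStep {m : Fin n} {b c : ℕ} (hb : w (π.1 (ofFin m.castSucc)) = b)
    (hc : w (π.1 (ofFin m.succ)) = c) :
    w.key (π.1 (ofFin m.castSucc)) < w.key (π.1 (ofFin m.succ)) ↔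
      ChainStep (SignedPerm.Descent π m) b c := by
  rw [key_lt_key_iff, hb, hc, ChainStep, SignedPerm.descent_iff, Nat.cast_lt, Nat.cast_inj]
  refine or_congr_right (and_congr_right ?_)
  rintro rfl
  obtain hpar | hpar := Nat.even_or_odd b
  · rw [Int.negOnePow_even _ ((Int.even_coe_nat b).2 hpar)]
    simpa [Nat.not_odd_iff_even.2 hpar] using
      (SignedPerm.apply_ofFin_succ_ne π m).symm.le_iff_lt.symm
  · rw [Int.negOnePow_odd _ ((Int.odd_coe_nat b).2 hpar)]
    simp [hpar]

theorem std_eq_iff_forall_chainStep (h : ∀ m, w (π.1 (ofFin m)) = a m) :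
    w.std = π ↔
      ∀ m : Fin n, ChainStep (SignedPerm.Descent π m) (a m.castSucc) (a m.succ) := by
  simp only [← key_lt_key_iff_chainStep (h _) (h _)]
  refine ⟨fun hstd m => w.std_eq_iff.1 hstd (ofFin_strictMono Fin.castSucc_lt_succ), fun hkey => ?_⟩
  refine w.std_eq_iff.2 (strictMono_of_odd (fun x => ?_) (Fin.strictMono_iff_lt_succ.2 hkey))
  rw [Function.comp_apply, SignedPerm.apply_neg, key_neg, Function.comp_apply]

theorem eq_of_forall_apply_eq {v : SignedWord n k} (π : SignedPerm n)
    (h : ∀ m, w (π.1 (ofFin m)) = v (π.1 (ofFin m))) : w = v := by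
  have hodd (u : SignedWord n k) (x : SignedInterval n) : u (π.1 x.neg) = -u (π.1 x) := by
    rw [SignedPerm.apply_neg, u.map_neg]
  exact DFunLike.coe_injective (π.1.surjective.injective_comp_right (odd_ext (hodd w) (hodd v) h))

theorem exists_forall_apply_eq (π : SignedPerm n) (h0 : a 0 = 0) (ha : ∀ m, a m ≤ k) :
    ∃ w : SignedWord n k, ∀ m, w (π.1 (ofFin m)) = a m := by
  obtain ⟨f, hodd, hf⟩ := exists_odd_extension (a := fun m => (a m : ℤ)) (by simpa using h0)
  refine ⟨⟨fun x => f (π⁻¹.1 x), fun x => ?_, fun x => ?_⟩, fun m => ?_⟩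
  · rw [SignedPerm.inv_apply_neg, hodd]
  · obtain ⟨m, hm | hm⟩ := (π⁻¹.1 x).exists_eq_ofFin_or_eq_neg <;>
      simp only [hm, hodd, abs_neg, hf, Nat.abs_cast, Nat.cast_le, ha m]
  · simp only [coe_mk, SignedPerm.inv_apply_self, hf]

open Classical in
theorem card_std_eq (n k : ℕ) (π : SignedPerm n) :
    (Finset.univ.filter fun w : SignedWord n k => w.std = π).card =
      ∑ c ∈ Finset.range (k + 1), (chains (SignedPerm.Descent π) n c).card := by
  rw [← Finset.card_biUnion]
  · refine Finset.card_bij (fun w _ m => (w (π.1 (ofFin m))).toNat) ?_ ?_ ?_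
    · intro w hw
      have hstd := (Finset.mem_filter.1 hw).2
      have hcast (m : Fin (n + 1)) := (Int.toNat_of_nonneg (apply_nonneg_of_std_eq hstd m)).symm
      refine Finset.mem_biUnion.2 ⟨_, ?_, mem_chains.2 ⟨?_, ?_, rfl⟩⟩
      · exact Finset.mem_range_succ_iff.2 (Int.toNat_le.2 (_root_.abs_le.1 (w.abs_le _)).2)
      · rw [apply_zero, Int.toNat_zero]
      · exact (std_eq_iff_forall_chainStep hcast).1 hstd
    · intro w hw v hv h
      refine eq_of_forall_apply_eq π fun m => ?_
      have hw0 := apply_nonneg_of_std_eq (Finset.mem_filter.1 hw).2 m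
      have hv0 := apply_nonneg_of_std_eq (Finset.mem_filter.1 hv).2 m
      rw [← Int.toNat_of_nonneg hw0, ← Int.toNat_of_nonneg hv0]
      exact congrArg Nat.cast (congrFun h m)
    · intro a ha
      obtain ⟨c, hc, ha⟩ := Finset.mem_biUnion.1 ha
      obtain ⟨h0, hstep, rfl⟩ := mem_chains.1 ha
      obtain ⟨w, hw⟩ := exists_forall_apply_eq (k := k) π h0 fun m =>
        (monotone_of_forall_chainStep hstep (Fin.le_last m)).trans (Finset.mem_range_succ_iff.1 hc)
      refine ⟨w, Finset.mem_filter.2 ⟨Finset.mem_univ w, ?_⟩, funext fun m => ?_⟩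
      · exact (std_eq_iff_forall_chainStep hw).2 hstep
      · rw [hw, Int.toNat_natCast]
  · intro c _ c' _ hne
    refine Finset.disjoint_left.2 fun a ha ha' => hne ?_
    exact (mem_chains.1 ha).2.2.symm.trans (mem_chains.1 ha').2.2

end CardStd

end SignedWord

/-! ### Generating functions -/

section PartialSums

open PowerSeries

variable {R : Type*} [Ring R]

/-- The generating function of the partial sums of `f` up to an even index. -/
def evenPartialSums (f : ℕ → R) : R⟦X⟧ := mk fun K => ∑ c ∈ Finset.range (2 * K + 1), f c

/-- The generating function of the partial sums of `f` up to an odd index. -/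
def oddPartialSums (f : ℕ → R) : R⟦X⟧ := mk fun K => ∑ c ∈ Finset.range (2 * K + 2), f c

theorem one_sub_X_mul_evenPartialSums (f : ℕ → R) :
    (1 - X) * evenPartialSums f = mk (fun e => f (2 * e)) + X * mk fun e => f (2 * e + 1) := by
  ext K
  cases K with
  | zero => simp [evenPartialSums, sub_mul]
  | succ K =>
    simp only [evenPartialSums, sub_mul, one_mul, map_sub, map_add, coeff_mk, coeff_succ_X_mul,
      mul_add, Finset.sum_range_succ]
    abel

theorem one_sub_X_mul_oddPartialSums (f : ℕ → R) :
    (1 - X) * oddPartialSums f = mk (fun e => f (2 * e)) + mk fun e => f (2 * e + 1) := by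
  ext K
  cases K with
  | zero => simp [oddPartialSums, sub_mul, Finset.sum_range_succ]
  | succ K =>
    simp only [oddPartialSums, sub_mul, one_mul, map_sub, map_add, coeff_mk, coeff_succ_X_mul,
      mul_add, Finset.sum_range_succ]
    abel

end PartialSums

section ChainSeries

open PowerSeries

/-- The generating function of the numbers of chains `0 = a₀ ≤ ⋯ ≤ aᵢ ≤ 2K` with
directions `d`. -/
noncomputable def evenChainSeries (d : ℕ → Prop) (i : ℕ) : ℚ⟦X⟧ :=
  evenPartialSums fun c => ((chains d i c).card : ℚ)

/-- The generating function of the numbers of chains `0 = a₀ ≤ ⋯ ≤ aᵢ ≤ 2K + 1` with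
directions `d`. -/
noncomputable def oddChainSeries (d : ℕ → Prop) (i : ℕ) : ℚ⟦X⟧ :=
  oddPartialSums fun c => ((chains d i c).card : ℚ)

variable {d : ℕ → Prop} {i : ℕ}

theorem mk_card_chains_succ_even_of_not (h : ¬d i) :
    (mk fun e => ((chains d (i + 1) (2 * e)).card : ℚ)) = evenChainSeries d i := by
  ext e
  rw [coeff_mk, card_chains_succ_of_odd_iff (by simp [h])]
  simp [evenChainSeries, evenPartialSums]

theorem mk_card_chains_succ_odd_of_not (h : ¬d i) :
    (mk fun e => ((chains d (i + 1) (2 * e + 1)).card : ℚ)) = evenChainSeries d i := by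
  ext e
  rw [coeff_mk, card_chains_succ_of_not_odd_iff (by simp [h])]
  simp [evenChainSeries, evenPartialSums]

theorem mk_card_chains_succ_even_of (h : d i) :
    (mk fun e => ((chains d (i + 1) (2 * e)).card : ℚ)) = X * oddChainSeries d i := by
  ext e
  rw [coeff_mk, card_chains_succ_of_not_odd_iff (by simp [h])]
  cases e with
  | zero => simp
  | succ e => simp [oddChainSeries, oddPartialSums, coeff_succ_X_mul, mul_add]

theorem mk_card_chains_succ_odd_of (h : d i) :
    (mk fun e => ((chains d (i + 1) (2 * e + 1)).card : ℚ)) = oddChainSeries d i := by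
  ext e
  rw [coeff_mk, card_chains_succ_of_odd_iff (by simp [h])]
  simp [oddChainSeries, oddPartialSums]

theorem one_sub_X_mul_evenChainSeries_succ_of_not (h : ¬d i) :
    (1 - X) * evenChainSeries d (i + 1) = (1 + X) * evenChainSeries d i := by
  rw [evenChainSeries, one_sub_X_mul_evenPartialSums, mk_card_chains_succ_even_of_not h,
    mk_card_chains_succ_odd_of_not h]
  ring

theorem one_sub_X_mul_oddChainSeries_succ_of_not (h : ¬d i) :
    (1 - X) * oddChainSeries d (i + 1) = 2 * evenChainSeries d i := by
  rw [oddChainSeries, one_sub_X_mul_oddPartialSums, mk_card_chains_succ_even_of_not h,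
    mk_card_chains_succ_odd_of_not h, two_mul]

theorem one_sub_X_mul_evenChainSeries_succ_of (h : d i) :
    (1 - X) * evenChainSeries d (i + 1) = 2 * X * oddChainSeries d i := by
  rw [evenChainSeries, one_sub_X_mul_evenPartialSums, mk_card_chains_succ_even_of h,
    mk_card_chains_succ_odd_of h]
  ring

theorem one_sub_X_mul_oddChainSeries_succ_of (h : d i) :
    (1 - X) * oddChainSeries d (i + 1) = (1 + X) * oddChainSeries d i := by
  rw [oddChainSeries, one_sub_X_mul_oddPartialSums, mk_card_chains_succ_even_of h,
    mk_card_chains_succ_odd_of h]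
  ring

theorem one_sub_X_mul_evenChainSeries_zero (d : ℕ → Prop) :
    (1 - X) * evenChainSeries d 0 = 1 := by
  rw [evenChainSeries, one_sub_X_mul_evenPartialSums]
  ext e
  cases e <;> simp [card_chains_zero, coeff_one, coeff_succ_X_mul]

theorem one_sub_X_mul_oddChainSeries_zero (d : ℕ → Prop) :
    (1 - X) * oddChainSeries d 0 = 1 := by
  rw [oddChainSeries, one_sub_X_mul_oddPartialSums]
  ext e
  simp [card_chains_zero, coeff_one]

theorem one_sub_X_ne_zero : (1 - X : ℚ⟦X⟧) ≠ 0 := fun h => by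
  simpa using congrArg (coeff 0) h

-- The last direction determines the odd series from the even one, so the odd series can be
-- eliminated from the recursion.
theorem one_add_X_mul_oddChainSeries_succ_of_not (h : ¬d i) :
    (1 + X) * oddChainSeries d (i + 1) = 2 * evenChainSeries d (i + 1) := by
  refine mul_left_cancel₀ one_sub_X_ne_zero ?_
  linear_combination (1 + X) * one_sub_X_mul_oddChainSeries_succ_of_not h -
    2 * one_sub_X_mul_evenChainSeries_succ_of_not h

theorem two_X_mul_oddChainSeries_succ_of (h : d i) :
    2 * X * oddChainSeries d (i + 1) = (1 + X) * evenChainSeries d (i + 1) := by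
  refine mul_left_cancel₀ one_sub_X_ne_zero ?_
  linear_combination 2 * X * one_sub_X_mul_oddChainSeries_succ_of h -
    (1 + X) * one_sub_X_mul_evenChainSeries_succ_of h

theorem one_sub_X_mul_evenChainSeries_add_two_of_not_peak (h : ¬(¬d i ∧ d (i + 1))) :
    (1 - X) * evenChainSeries d (i + 2) = (1 + X) * evenChainSeries d (i + 1) := by
  by_cases hlast : d (i + 1)
  · have hprev : d i := not_not.1 fun hprev => h ⟨hprev, hlast⟩
    rw [one_sub_X_mul_evenChainSeries_succ_of hlast, two_X_mul_oddChainSeries_succ_of hprev]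
  · exact one_sub_X_mul_evenChainSeries_succ_of_not hlast

theorem one_sub_X_mul_evenChainSeries_add_two_of_peak (h : ¬d i ∧ d (i + 1)) :
    (1 - X) * ((1 + X) * evenChainSeries d (i + 2)) = 4 * X * evenChainSeries d (i + 1) := by
  linear_combination (1 + X) * one_sub_X_mul_evenChainSeries_succ_of h.2 +
    2 * X * one_add_X_mul_oddChainSeries_succ_of_not h.1

end ChainSeries

section PeakIndex

variable {d d' : ℕ → Prop} {i j : ℕ}

open Classical in
/-- Twice the number of peaks of a sequence of steps `d 0, …, d i`, plus one if the first step is a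
descent. -/
noncomputable def peakIndex (d : ℕ → Prop) (i : ℕ) : ℕ :=
  2 * ((Finset.range i).filter fun m => ¬d m ∧ d (m + 1)).card + if d 0 then 1 else 0

open Classical in
theorem peakIndex_zero (d : ℕ → Prop) : peakIndex d 0 = if d 0 then 1 else 0 := by
  simp [peakIndex]

theorem peakIndex_succ_of_peak (h : ¬d i ∧ d (i + 1)) :
    peakIndex d (i + 1) = peakIndex d i + 2 := by
  classical
  rw [peakIndex, peakIndex, Finset.range_add_one, Finset.filter_insert, if_pos h,
    Finset.card_insert_of_notMem (by simp)]
  ring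

theorem peakIndex_succ_of_not_peak (h : ¬(¬d i ∧ d (i + 1))) :
    peakIndex d (i + 1) = peakIndex d i := by
  classical
  rw [peakIndex, peakIndex, Finset.range_add_one, Finset.filter_insert, if_neg h]

theorem peakIndex_le_and_le_of_not (d : ℕ → Prop) (i : ℕ) :
    peakIndex d i ≤ i + 1 ∧ (¬d i → peakIndex d i ≤ i) := by
  classical
  induction i with
  | zero => rw [peakIndex_zero]; split_ifs <;> simp_all
  | succ i ih =>
    by_cases h : ¬d i ∧ d (i + 1)
    · rw [peakIndex_succ_of_peak h]
      exact ⟨Nat.add_le_add_right (ih.2 h.1) 2, fun hlast => absurd h.2 hlast⟩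
    · rw [peakIndex_succ_of_not_peak h]
      exact ⟨ih.1.trans (Nat.le_succ _), fun _ => ih.1⟩

theorem peakIndex_congr (h : ∀ m ≤ i, d m ↔ d' m) : peakIndex d i = peakIndex d' i := by
  classical
  have hpeak : ∀ m ∈ Finset.range i, (¬d m ∧ d (m + 1)) ↔ (¬d' m ∧ d' (m + 1)) := fun m hm => by
    rw [h m (Finset.mem_range.1 hm).le, h (m + 1) (Finset.mem_range.1 hm)]
  rw [peakIndex, peakIndex, Finset.filter_congr hpeak]
  simp only [h 0 (Nat.zero_le i)]

-- The second conjunct carries the induction: a descent appended to `d` must create a peak.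
theorem exists_peakIndex_eq (h : j ≤ i + 1) : ∃ d, peakIndex d i = j ∧ (d i ↔ j = i + 1) := by
  classical
  induction i generalizing j with
  | zero =>
    refine ⟨fun _ => j = 1, ?_, Iff.rfl⟩
    rw [peakIndex_zero]
    split_ifs <;> omega
  | succ i ih =>
    have hupdate (d : ℕ → Prop) (D : Prop) :
        peakIndex (Function.update d (i + 1) D) i = peakIndex d i :=
      peakIndex_congr fun m hm => by rw [Function.update_of_ne (by omega)]
    obtain hj | rfl := Nat.le_succ_iff.1 h
    · obtain ⟨d, hd, -⟩ := ih hj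
      refine ⟨Function.update d (i + 1) False, ?_, by simp; omega⟩
      rw [peakIndex_succ_of_not_peak (by simp), hupdate, hd]
    · obtain ⟨d, hd, hlast⟩ := ih (Nat.le_succ i)
      refine ⟨Function.update d (i + 1) True, ?_, by simp⟩
      rw [peakIndex_succ_of_peak (by simp [hlast]), hupdate, hd]

end PeakIndex

section PeakPoly

open Polynomial

/-- The numerator of `peakSeries n j` over the denominator `(1 - X) ^ (n + 1)`. -/
noncomputable def peakPoly (n j : ℕ) : ℚ[X] := 2 ^ j * X ^ ((j + 1) / 2) * (1 + X) ^ (n - j)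

theorem peakPoly_succ {n j : ℕ} (h : j ≤ n) : peakPoly (n + 1) j = (1 + X) * peakPoly n j := by
  rw [peakPoly, peakPoly, Nat.succ_sub h, pow_succ]
  ring

theorem linearIndependent_peakPoly (n : ℕ) :
    LinearIndependent ℚ fun j : Fin (n + 1) => peakPoly n j := by
  induction n with
  | zero => exact LinearIndependent.of_subsingleton (ι := Fin 1) 0 (by simp [peakPoly])
  | succ n ih =>
    -- All these polynomials except the last one are divisible by `1 + X`.
    have hinit : Fin.init (fun j : Fin (n + 2) => peakPoly (n + 1) j) =
        LinearMap.mulLeft ℚ (1 + X : ℚ[X]) ∘ fun j : Fin (n + 1) => peakPoly n j :=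
      funext fun j => peakPoly_succ (Nat.lt_succ_iff.1 j.2)
    have hne : (1 + X : ℚ[X]) ≠ 0 := fun h => by simpa using congrArg (Polynomial.eval 0) h
    refine linearIndependent_finSucc'.2 ⟨?_, fun hmem => ?_⟩
    · rw [hinit]
      exact ih.map' _ (LinearMap.ker_eq_bot.2 (mul_right_injective₀ hne))
    · have hroot : Submodule.span ℚ (Set.range (Fin.init fun j : Fin (n + 2) =>
          peakPoly (n + 1) j)) ≤ LinearMap.ker (leval (-1 : ℚ)) := by
        rw [hinit, Submodule.span_le]
        rintro _ ⟨j, rfl⟩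
        simp
      simpa [peakPoly] using hroot hmem

end PeakPoly

section PeakSeries

open PowerSeries

/-- The generating function in `K` of the number of words of length `n` in the alphabet `±[2K]`
whose standardization is a given signed permutation of peak index `j`. -/
noncomputable def peakSeries (n j : ℕ) : ℚ⟦X⟧ := ((1 - X) ^ (n + 1))⁻¹ * peakPoly n j

theorem linearIndependent_peakSeries (n : ℕ) :
    LinearIndependent ℚ fun j : Fin (n + 1) => peakSeries n j := by
  have hne : ((1 - X : ℚ⟦X⟧) ^ (n + 1))⁻¹ ≠ 0 := fun h => by
    simpa using congrArg constantCoeff h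
  have hcoe := (linearIndependent_peakPoly n).map'
    (Polynomial.coeToPowerSeries.algHom (R := ℚ) ℚ).toLinearMap
    (LinearMap.ker_eq_bot.2 fun p q h => Polynomial.coe_injective ℚ (by simpa using h))
  exact hcoe.map' (LinearMap.mulLeft ℚ ((1 - X : ℚ⟦X⟧) ^ (n + 1))⁻¹)
    (LinearMap.ker_eq_bot.2 (mul_right_injective₀ hne))

theorem one_sub_X_pow_mul_evenChainSeries (d : ℕ → Prop) (i : ℕ) :
    (1 - X) ^ (i + 2) * ((1 + X) ^ peakIndex d i * evenChainSeries d (i + 1)) =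
      2 ^ peakIndex d i * X ^ ((peakIndex d i + 1) / 2) * (1 + X) ^ (i + 1) := by
  induction i with
  | zero =>
    by_cases h : d 0
    · simp only [peakIndex_zero, if_pos h]
      linear_combination (1 - X) * (1 + X) * one_sub_X_mul_evenChainSeries_succ_of h +
        2 * X * (1 + X) * one_sub_X_mul_oddChainSeries_zero d
    · simp only [peakIndex_zero, if_neg h]
      linear_combination (1 - X) * one_sub_X_mul_evenChainSeries_succ_of_not h +
        (1 + X) * one_sub_X_mul_evenChainSeries_zero d
  | succ i ih =>
    by_cases h : ¬d i ∧ d (i + 1)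
    · rw [peakIndex_succ_of_peak h,
        show (peakIndex d i + 2 + 1) / 2 = (peakIndex d i + 1) / 2 + 1 by omega]
      linear_combination 4 * X * (1 + X) * ih + (1 - X) ^ (i + 2) * (1 + X) ^ (peakIndex d i + 1) *
        one_sub_X_mul_evenChainSeries_add_two_of_peak h
    · rw [peakIndex_succ_of_not_peak h]
      linear_combination (1 + X) * ih + (1 - X) ^ (i + 2) * (1 + X) ^ peakIndex d i *
        one_sub_X_mul_evenChainSeries_add_two_of_not_peak h

theorem evenChainSeries_succ_eq_peakSeries (d : ℕ → Prop) (i : ℕ) :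
    evenChainSeries d (i + 1) = peakSeries (i + 1) (peakIndex d i) := by
  have hle := (peakIndex_le_and_le_of_not d i).1
  have hne : (1 + X : ℚ⟦X⟧) ≠ 0 := fun h => by simpa using congrArg constantCoeff h
  have hcancel : (1 - X) ^ (i + 2) * evenChainSeries d (i + 1) =
      (peakPoly (i + 1) (peakIndex d i) : ℚ⟦X⟧) := by
    refine mul_left_cancel₀ (pow_ne_zero (peakIndex d i) hne) ?_
    rw [mul_left_comm, one_sub_X_pow_mul_evenChainSeries, ← pow_mul_pow_sub (1 + X : ℚ⟦X⟧) hle]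
    have htwo : ((2 : Polynomial ℚ) : ℚ⟦X⟧) = 2 := map_ofNat Polynomial.coeToPowerSeries.ringHom 2
    simp only [peakPoly, Polynomial.coe_mul, Polynomial.coe_pow, Polynomial.coe_add,
      Polynomial.coe_one, Polynomial.coe_X, htwo]
    ring
  rw [peakSeries, ← hcancel, ← mul_assoc, PowerSeries.inv_mul_cancel _ (by simp), one_mul]

end PeakSeries

/-! ### The peak algebra -/

namespace SignedPerm

variable {n : ℕ}

open Classical in
/-- The signed permutation that changes the sign of `m + 1` for all `m` in `d`. -/
noncomputable def signChange (n : ℕ) (d : ℕ → Prop) : SignedPerm n :=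
  have hinvol : Involutive fun x : SignedInterval n =>
      if d ((x : ℤ).natAbs - 1) then x.neg else x := fun x => by
    dsimp only
    split_ifs <;> simp_all
  ⟨hinvol.toPerm, fun x => by
    simp only [Involutive.coe_toPerm, coe_neg, Int.natAbs_neg]
    split_ifs <;> rfl⟩

open Classical in
theorem app_signChange (d : ℕ → Prop) (m : Fin (n + 1)) :
    app (signChange n d) (m : ℕ) = if d (m - 1) then -(m : ℤ) else m := by
  rw [app_natCast]
  change (((if d (m - 1) then (ofFin m).neg else ofFin m) : SignedInterval n) : ℤ) = _
  split_ifs <;> rfl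

theorem descent_signChange_iff (d : ℕ → Prop) (m : Fin n) :
    Descent (signChange n d) m ↔ d m := by
  classical
  have hsucc := app_signChange d m.succ
  have hcast := app_signChange d m.castSucc
  simp only [Fin.val_succ, Nat.add_sub_cancel, Nat.cast_add, Nat.cast_one, Fin.val_castSucc]
    at hsucc hcast
  rw [Descent, hsucc, hcast]
  split_ifs <;> simp_all <;> omega

theorem descent_zero_iff (π : SignedPerm n) : Descent π 0 ↔ app π 1 < 0 := by
  rw [Descent, Nat.cast_zero, zero_add, app_zero]

theorem mem_peakSet_succ_iff (π : SignedPerm (n + 1)) (m : ℕ) :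
    (m + 1 : ℤ) ∈ peakSet π ↔ m < n ∧ ¬Descent π m ∧ Descent π (m + 1) := by
  simp only [peakSet, Finset.mem_filter, Finset.mem_Icc, Descent, add_sub_cancel_right,
    Nat.cast_add, Nat.cast_one, not_lt]
  rw [show (1 ≤ (m : ℤ) + 1 ∧ (m : ℤ) + 1 ≤ n) ↔ m < n by omega]
  refine and_congr_right fun hm => and_congr_left' ?_
  exact (app_succ_ne π ⟨m, Nat.lt_succ_of_lt hm⟩).symm.le_iff_lt.symm

open Classical in
theorem card_filter_peak (π : SignedPerm (n + 1)) :
    ((Finset.range n).filter fun m => ¬Descent π m ∧ Descent π (m + 1)).card = peakNumber π := by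
  refine Finset.card_bij (fun m _ => (m : ℤ) + 1) (fun m hm => ?_) (fun m _ m' _ h => ?_)
    fun i hi => ?_
  · rw [Finset.mem_filter, Finset.mem_range] at hm
    exact (mem_peakSet_succ_iff π m).2 hm
  · exact_mod_cast add_right_cancel h
  · have hpos := (Finset.mem_Icc.1 (Finset.mem_filter.1 hi).1).1
    obtain ⟨m, rfl⟩ : ∃ m : ℕ, i = m + 1 := ⟨(i - 1).toNat, by omega⟩
    refine ⟨m, ?_, rfl⟩
    rw [Finset.mem_filter, Finset.mem_range]
    exact (mem_peakSet_succ_iff π m).1 hi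

/-- The peak class of a signed permutation: twice the number of its peaks, plus one if
`π(1) < 0`. -/
noncomputable def peakClass (π : SignedPerm (n + 1)) : Fin (n + 2) :=
  ⟨peakIndex (Descent π) n, Nat.lt_succ_of_le (peakIndex_le_and_le_of_not _ n).1⟩

theorem coe_peakClass (π : SignedPerm (n + 1)) :
    (peakClass π : ℕ) = 2 * peakNumber π + if app π 1 < 0 then 1 else 0 := by
  classical
  rw [← card_filter_peak]
  simp only [peakClass, peakIndex, descent_zero_iff]

theorem app_one_ne_zero (π : SignedPerm (n + 1)) : app π 1 ≠ 0 := by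
  simpa [app_zero] using app_succ_ne π 0

theorem coe_peakClass_eq_two_mul_iff (π : SignedPerm (n + 1)) (p : ℕ) :
    (peakClass π : ℕ) = 2 * p ↔ peakNumber π = p ∧ 0 < app π 1 := by
  have hne := app_one_ne_zero π
  rw [coe_peakClass]
  split_ifs <;> omega

theorem coe_peakClass_eq_two_mul_add_one_iff (π : SignedPerm (n + 1)) (p : ℕ) :
    (peakClass π : ℕ) = 2 * p + 1 ↔ peakNumber π = p ∧ app π 1 < 0 := by
  rw [coe_peakClass]
  split_ifs <;> omega

theorem peakClass_surjective : Surjective (peakClass : SignedPerm (n + 1) → Fin (n + 2)) := by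
  intro j
  obtain ⟨d, hd, -⟩ := exists_peakIndex_eq (Nat.lt_succ_iff.1 j.2)
  refine ⟨signChange (n + 1) d, Fin.ext ?_⟩
  refine (peakIndex_congr fun m hm => ?_).trans hd
  exact descent_signChange_iff d ⟨m, Nat.lt_succ_of_le hm⟩

end SignedPerm

section StatisticSum

variable {R G ι : Type*} [Semiring R] {s : G → ι}

/-- The sum of the elements `g` of the group algebra with coefficients `a (s g)`, as a linear
function of `a`. -/
noncomputable def statisticSum (R : Type*) [Semiring R] [Finite G] (s : G → ι) :
    (ι → R) →ₗ[R] MonoidAlgebra R G :=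
  (MonoidAlgebra.coeffLinearEquiv R).symm.toLinearMap ∘ₗ
    (Finsupp.linearEquivFunOnFinite R R G).symm.toLinearMap ∘ₗ LinearMap.funLeft R R s

theorem coeff_statisticSum [Finite G] (s : G → ι) (a : ι → R) (g : G) :
    (statisticSum R s a).coeff g = a (s g) := rfl

theorem statisticSum_injective [Finite G] (hs : Surjective s) : Injective (statisticSum R s) :=
  (MonoidAlgebra.coeffLinearEquiv R).symm.injective.comp <|
    (Finsupp.linearEquivFunOnFinite R R G).symm.injective.comp <|
      LinearMap.funLeft_injective_of_surjective R R s hs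

theorem sum_filter_of_eq_statisticSum [Fintype G] [MulOneClass G] (P : ι → Prop) [DecidablePred P]
    (Q : G → Prop) [DecidablePred Q] (h : ∀ g, Q g ↔ P (s g)) :
    ∑ g with Q g, MonoidAlgebra.of R G g = statisticSum R s fun i => if P i then 1 else 0 := by
  classical
  ext g
  simp [MonoidAlgebra.coeff_sum, Finsupp.single_apply, coeff_statisticSum, h]

end StatisticSum

section PeakSpan

open SignedPerm

variable (n : ℕ)

theorem peakSumPos_eq_statisticSum (p : ℕ) :
    peakSumPos (n + 1) p = statisticSum ℚ peakClass fun j => if (j : ℕ) = 2 * p then 1 else 0 :=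
  sum_filter_of_eq_statisticSum _ _ fun π => (coe_peakClass_eq_two_mul_iff π p).symm

theorem peakSumNeg_eq_statisticSum (p : ℕ) :
    peakSumNeg (n + 1) p =
      statisticSum ℚ peakClass fun j => if (j : ℕ) = 2 * p + 1 then 1 else 0 :=
  sum_filter_of_eq_statisticSum _ _ fun π => (coe_peakClass_eq_two_mul_add_one_iff π p).symm

theorem peakSpanB_succ_eq_range :
    peakSpanB (n + 1) = LinearMap.range (statisticSum ℚ (peakClass (n := n))) := by
  refine le_antisymm (Submodule.span_le.2 ?_) ?_
  · rintro _ (⟨p, rfl⟩ | ⟨p, rfl⟩)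
    exacts [⟨_, (peakSumPos_eq_statisticSum n p).symm⟩, ⟨_, (peakSumNeg_eq_statisticSum n p).symm⟩]
  · rw [LinearMap.range_eq_map, ← (Pi.basisFun ℚ (Fin (n + 2))).span_eq, Submodule.map_span_le]
    rintro _ ⟨j, rfl⟩
    refine Submodule.subset_span ?_
    have hsingle : Pi.basisFun ℚ (Fin (n + 2)) j =
        (fun i : Fin (n + 2) => if (i : ℕ) = j then 1 else 0) := by
      ext i
      simp [Pi.single_apply, Fin.ext_iff]
    rw [hsingle]
    obtain ⟨p, hp | hp⟩ := Nat.even_or_odd' (j : ℕ)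
    · exact .inl ⟨p, by rw [hp, peakSumPos_eq_statisticSum]⟩
    · exact .inr ⟨p, by rw [hp, peakSumNeg_eq_statisticSum]⟩

theorem finrank_peakSpanB_succ : Module.finrank ℚ (peakSpanB (n + 1)) = n + 2 := by
  rw [peakSpanB_succ_eq_range, LinearMap.finrank_range_of_inj
    (statisticSum_injective peakClass_surjective), Module.finrank_fin_fun]

theorem stdSum_two_mul_eq_statisticSum (K : ℕ) :
    SignedWord.stdSum (n + 1) (2 * K) =
      statisticSum ℚ peakClass fun j => PowerSeries.coeff K (peakSeries (n + 1) j) := by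
  classical
  ext π
  have hcard : (SignedWord.stdSum (n + 1) (2 * K)).coeff π =
      (Finset.univ.filter fun w : SignedWord (n + 1) (2 * K) => w.std = π).card := by
    simp [SignedWord.stdSum, MonoidAlgebra.coeff_sum, Finsupp.single_apply]
  rw [hcard, SignedWord.card_std_eq, coeff_statisticSum, peakClass,
    ← evenChainSeries_succ_eq_peakSeries, evenChainSeries, evenPartialSums, PowerSeries.coeff_mk,
    Nat.cast_sum]

theorem span_range_coeff_peakSeries :
    Submodule.span ℚ (Set.range fun (K : ℕ) (j : Fin (n + 1)) =>
      PowerSeries.coeff K (peakSeries n j)) = ⊤ := by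
  let coeffs : PowerSeries ℚ →ₗ[ℚ] ℕ → ℚ := LinearMap.pi PowerSeries.coeff
  have hker : LinearMap.ker coeffs = ⊥ :=
    LinearMap.ker_eq_bot.2 fun _ _ h => PowerSeries.ext (congrFun h)
  exact span_flip_eq_top_iff_linearIndependent.2
    ((linearIndependent_peakSeries n).map' coeffs hker)

theorem peakSpanB_succ_eq_span_stdSum :
    peakSpanB (n + 1) =
      Submodule.span ℚ (Set.range fun K => SignedWord.stdSum (n + 1) (2 * K)) := by
  rw [peakSpanB_succ_eq_range, LinearMap.range_eq_map, ← span_range_coeff_peakSeries,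
    Submodule.map_span, ← Set.range_comp]
  simp only [Function.comp_def, stdSum_two_mul_eq_statisticSum]

end PeakSpan

/-- The multiplicative monoid of the sums of the standardizations of all words in the alphabets
`±[2K]`. -/
def evenStdSums (n : ℕ) : Submonoid (MonoidAlgebra ℚ (SignedPerm n)) where
  carrier := Set.range fun K => SignedWord.stdSum n (2 * K)
  one_mem' := ⟨0, SignedWord.stdSum_zero n⟩
  mul_mem' := by
    rintro _ _ ⟨K, rfl⟩ ⟨L, rfl⟩
    exact ⟨4 * K * L + K + L, (congrArg _ (by ring)).trans (SignedWord.stdSum_mul n _ _).symm⟩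

theorem isMulCommutative_adjoin_evenStdSums (n : ℕ) :
    IsMulCommutative (Algebra.adjoin ℚ (evenStdSums n : Set (MonoidAlgebra ℚ (SignedPerm n)))) := by
  refine Algebra.isMulCommutative_adjoin ℚ ?_
  rintro _ ⟨K, rfl⟩ _ ⟨L, rfl⟩
  exact SignedWord.stdSum_comm n (2 * K) (2 * L)

theorem toSubmodule_adjoin_evenStdSums_succ (n : ℕ) :
    Subalgebra.toSubmodule
      (Algebra.adjoin ℚ (evenStdSums (n + 1) : Set (MonoidAlgebra ℚ (SignedPerm (n + 1))))) =
      peakSpanB (n + 1) := by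
  rw [Algebra.adjoin_eq_span, Submonoid.closure_eq, peakSpanB_succ_eq_span_stdSum]
  rfl

theorem mainTheorem9 (n : ℕ) (hn : 1 ≤ n) :
    ∃ A : Subalgebra ℚ (MonoidAlgebra ℚ (SignedPerm n)),
      Subalgebra.toSubmodule A = peakSpanB n ∧
      (∀ x ∈ A, ∀ y ∈ A, x * y = y * x) ∧
      Module.finrank ℚ A = n + 1 := by
  obtain ⟨m, rfl⟩ := Nat.exists_eq_add_of_le' hn
  have hspan := toSubmodule_adjoin_evenStdSums_succ m
  have := isMulCommutative_adjoin_evenStdSums (m + 1)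
  refine ⟨_, hspan, fun x hx y hy => setLike_mul_comm hx hy, ?_⟩
  rw [← Subalgebra.finrank_toSubmodule, hspan, finrank_peakSpanB_succ]
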